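/- **Conventions.** A ribbon graph $G$ is a surface with boundary, written as the union of finitely many vertex discs and edge discs that meet in disjoint line segments, each lying on the boundary of exactly one vertex and exactly one edge, every edge containing exactly two of them; $G$ is considered up to homeomorphism, i.e. through its gluing data. It is a bouquet if it has exactly one vertex. For $A\subseteq E(G)$, $(V(G),A)$ is the spanning ribbon subgraph obtained by deleting the edges outside $A$; $A$ is the edge set of a spanning quasi-tree if $(V(G),A)$ has exactly one boundary component, and $\tau(G)$ is the number of such $A$. The partial dual $G^{\delta(A)}$ is obtained by gluing a disc along each boundary component of $(V(G),A)$ (these discs are the new vertices), removing the interiors of the old vertex discs and keeping the edges. A signed rotation $\sigma$ of a bouquet with edge set $[n]$ is the cyclic sequence of length $2n$ of the half-edges met when going once around the vertex, the two occurrences of the loop $i$ being labelled $i^a$ and $i^b$ (in either order), with signs such that $i^a$ and $i^b$ have the same sign if the loop $i$ is orientable and opposite signs if it is not. Its symbolic skew-adjacency matrix $\mathbf A^s_\sigma$ is the $n\times n$ matrix over $\mathbb Z[x_{ij}: i,j\in[n]]$ with diagonal entries $x_{ii}$ if the signs of $i^a,i^b$ are opposite and $0$ otherwise; for $i<j$ its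 $(i,j)$ entry is $x_{ij}$ if the cyclic order is $i^a,j^a,i^b,j^b$, $-x_{ij}$ if it is $i^a,j^b,i^b,j^a$, and $0$ otherwise; and its $(j,i)$ entry is minus its $(i,j)$ entry. Let $R_n$ be the ring that is free as a $\mathbb Z$-module on $x_A$, $A\subseteq[n]$, with $x_Ax_B=x_{A\cup B}$ and $1=x_\emptyset$. The map $f:\mathbb Z[x_{ij}]\to R_n$ is the $\mathbb Z$-linear map sending a monomial to $x_A$, where $A$ is the union of the sets $\{i,j\}$ over the variables $x_{ij}$ occurring in it. For $P\in R_n$, $P \bmod 2\in R_n$ is obtained by replacing each coefficient by its remainder in $\{0,1\}$ modulo $2$. **Corollary 4.5.** Let $G$ be a connected ribbon graph with edge set $[n]$ and let $T$ be the edge set of a spanning quasi-tree of $G$. Then $G^{\delta(T)}$ is a bouquet, and for every signed rotation $\sigma$ of $G^{\delta(T)}$ $$f(\det(I_n+\mathbf A^s_\sigma)) \bmod 2=\sum_X x_X,$$ where the sum is over all $X\subseteq[n]$ such that $X\,\Delta\, T$ is the edge set of a spanning quasi-tree of $G$. Consequently $$\tau(G)=\big(f(\det(I_n+\mathbf A^s_\sigma))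 \bmod 2\big)\big|_{x_X=1 \text{ for all } X}.$$ -/

import Mathlib

/-- A (finite, possibly non-orientable) ribbon graph with edge set `E`, given by its gluing data.

Each edge is a disc, seen as a rectangle with four corners.  Two opposite sides of this rectangle
are the line segments in which the edge meets the vertices, the other two are its free sides.
The boundary circle of a vertex is cut by the line segments on it into arcs.  Every corner `x` is
thus an end of exactly one line segment (whose other end is `seg x`), of exactly one free side
(whose other end is `side x`) and of exactly one arc of a vertex boundary (whose other end is
`arc x`).  Vertices may be isolated, that is, have no corners on them. -/
structure RibbonGraph (E : Type) where
  Vertex : Type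
  Corner : Type
  finite_vertex : Finite Vertex
  finite_corner : Finite Corner
  /-- the edge of which `x` is a corner -/
  edge : Corner → E
  /-- the vertex on whose boundary `x` lies -/
  vert : Corner → Vertex
  seg : Corner → Corner
  side : Corner → Corner
  arc : Corner → Corner
  seg_seg : ∀ x, seg (seg x) = x
  side_side : ∀ x, side (side x) = x
  arc_arc : ∀ x, arc (arc x) = x
  seg_ne : ∀ x, seg x ≠ x
  side_ne : ∀ x, side x ≠ x
  arc_ne : ∀ x, arc x ≠ x
  seg_ne_side : ∀ x, seg x ≠ side x
  seg_side : ∀ x, seg (side x) = side (seg x)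
  edge_surjective : Function.Surjective edge
  /-- the corners of an edge are the four corners of one rectangle -/
  edge_eq_iff : ∀ x y, edge x = edge y ↔ y = x ∨ y = seg x ∨ y = side x ∨ y = seg (side x)
  /-- the line segments and arcs on the boundary of a vertex form a single circle -/
  vert_eq_iff : ∀ x y, vert x = vert y ↔
    Relation.EqvGen (fun a b => b = seg a ∨ b = arc a) x y

namespace RibbonGraph

variable {E : Type} (G : RibbonGraph E)

theorem edge_seg (x : G.Corner) : G.edge (G.seg x) = G.edge x :=
  ((G.edge_eq_iff _ _).2 (Or.inr (Or.inl rfl))).symm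

theorem edge_side (x : G.Corner) : G.edge (G.side x) = G.edge x :=
  ((G.edge_eq_iff _ _).2 (Or.inr (Or.inr (Or.inl rfl)))).symm

variable [DecidableEq E]

/-- The underlying surface (equivalently, the underlying graph) is non-empty and connected: any two
vertices are joined by a chain of edges. -/
def Connected : Prop :=
  Nonempty G.Vertex ∧
    ∀ u v, Relation.ReflTransGen (fun u v => ∃ x, G.vert x = u ∧ G.vert (G.side x) = v) u v

/-- A bouquet is a ribbon graph with exactly one vertex. -/
def IsBouquet : Prop := Nat.card G.Vertex = 1

/-- The boundary of the spanning ribbon subgraph `(V(G), A)` runs, at a corner of an edge of `A`,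
along the free side of that edge; at a corner of an edge not in `A` (which is deleted) it runs
along the line segment in which the deleted edge met its vertex. -/
def turn (A : Finset E) (x : G.Corner) : G.Corner :=
  if G.edge x ∈ A then G.side x else G.seg x

/-- The boundary components of the spanning ribbon subgraph `(V(G), A)`: the closed curves made of
arcs and of the pieces described in `turn`, and the boundary circles of the vertices of `G` that
carry no edge of `G` at all. -/
def BoundaryComponent (A : Finset E) : Type :=
  Quot (fun a b : G.Corner => b = G.turn A a ∨ b = G.arc a) ⊕ {v : G.Vertex // v ∉ Set.range G.vert}

/-- `A` is the edge set of a spanning quasi-tree of `G`: the spanning ribbon subgraph `(V(G), A)`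
has exactly one boundary component. -/
def IsSpanningQuasiTree (A : Finset E) : Prop := Nat.card (G.BoundaryComponent A) = 1

noncomputable instance : DecidablePred G.IsSpanningQuasiTree :=
  fun _ => Classical.propDecidable _

/-- The number `τ(G)` of spanning quasi-trees of `G`. -/
noncomputable def numSpanningQuasiTrees : ℕ := Nat.card {A : Finset E // G.IsSpanningQuasiTree A}

/-- The partial dual `G^{δ(A)}`.  A disc is glued along each boundary component of the spanning
ribbon subgraph `(V(G), A)`; these discs are the new vertices and the old vertices are removed.  The
edge discs are unchanged, so the corners are the same; an edge of `A` now meets the vertices in what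
were its free sides, and its former line segments become free. -/
def partialDual (A : Finset E) : RibbonGraph E where
  Vertex := G.BoundaryComponent A
  Corner := G.Corner
  finite_vertex := by
    have := G.finite_vertex
    have := G.finite_corner
    unfold BoundaryComponent
    infer_instance
  finite_corner := G.finite_corner
  edge := G.edge
  vert x := Sum.inl (Quot.mk _ x)
  seg := G.turn A
  side x := if G.edge x ∈ A then G.seg x else G.side x
  arc := G.arc
  seg_seg x := by
    by_cases h : G.edge x ∈ A <;> simp [turn, h, edge_seg, edge_side, seg_seg, side_side]
  side_side x := by
    by_cases h : G.edge x ∈ A <;> simp [h, edge_seg, edge_side, seg_seg, side_side]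
  arc_arc := G.arc_arc
  seg_ne x := by
    by_cases h : G.edge x ∈ A <;> simp [turn, h, seg_ne, side_ne]
  side_ne x := by
    by_cases h : G.edge x ∈ A <;> simp [h, seg_ne, side_ne]
  arc_ne := G.arc_ne
  seg_ne_side x := by
    by_cases h : G.edge x ∈ A
    · simpa [turn, h] using (G.seg_ne_side x).symm
    · simpa [turn, h] using G.seg_ne_side x
  seg_side x := by
    by_cases h : G.edge x ∈ A <;> simp [turn, h, edge_seg, edge_side, seg_side]
  edge_surjective := G.edge_surjective
  edge_eq_iff x y := by
    rw [G.edge_eq_iff]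
    by_cases h : G.edge x ∈ A
    · simp only [turn, h, edge_seg, if_true, seg_side]
      tauto
    · simp only [turn, h, edge_side, if_false]
  vert_eq_iff x y := by
    exact Sum.inl_injective.eq_iff.trans Quot.eq

/-- The spanning ribbon subgraph `(V(G), A)` is orientable.  An orientation of a vertex disc amounts
to telling apart, along its oriented boundary, the corners at which a line segment is entered from
those at which it is left; it extends over an edge disc if and only if the two ends of each free
side of that edge are of different kinds. -/
def IsOrientable (A : Finset E) : Prop :=
  ∃ o : G.Corner → Bool, (∀ x, o (G.seg x) = !o x) ∧ (∀ x, o (G.arc x) = !o x) ∧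
    ∀ x, G.edge x ∈ A → o (G.side x) = !o x

end RibbonGraph

/-- A signed rotation on the loops `1, …, n`: a cyclic sequence of length `2n` (written down from
some starting point) in which each of the labels `i^a = (i, true)` and `i^b = (i, false)` occurs
exactly once, and a sign for each label.  `pos` gives the position of each label. -/
structure SignedRotation (n : ℕ) where
  pos : Fin n × Bool ≃ Fin (2 * n)
  sign : Fin n × Bool → ℤˣ

/-- `σ` is a signed rotation of the bouquet `B`.  Going once around the boundary of the vertex,
one meets the `2n` line segments (half-edges) of `B`; the `k`-th one is entered at the corner `c k`
and left at the corner `seg (c k)`, from which an arc leads to the next one.  The labels at the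
successive positions of `σ` are those of the loops that are met, and the signs of `i^a` and `i^b`
agree exactly if `i` is an orientable loop. -/
def RibbonGraph.IsSignedRotation {n : ℕ} (B : RibbonGraph (Fin n)) (σ : SignedRotation n) : Prop :=
  (∃ c : Fin (2 * n) → B.Corner,
    (∀ k, c (finRotate (2 * n) k) = B.arc (B.seg (c k))) ∧
    (∀ k l, c l = c k ∨ c l = B.seg (c k) → k = l) ∧
    (∀ k, B.edge (c k) = (σ.pos.symm k).1)) ∧
  ∀ i, σ.sign (i, true) = σ.sign (i, false) ↔ B.IsOrientable {i}

namespace SignedRotation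

variable {n : ℕ} (σ : SignedRotation n)

/-- The four labels occur in the cyclic order `p, q, r, s`. -/
def CyclicOrder (p q r s : Fin n × Bool) : Prop :=
  sbtw (σ.pos p) (σ.pos q) (σ.pos r) ∧ sbtw (σ.pos r) (σ.pos s) (σ.pos p)

open Classical in
/-- The entries `(i, j)` with `i < j` of the symbolic skew-adjacency matrix. -/
noncomputable def upperEntry (i j : Fin n) : MvPolynomial (Fin n × Fin n) ℤ :=
  if σ.CyclicOrder (i, true) (j, true) (i, false) (j, false) then MvPolynomial.X (i, j)
  else if σ.CyclicOrder (i, true) (j, false) (i, false) (j, true) then -MvPolynomial.X (i, j)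
  else 0

/-- The symbolic skew-adjacency matrix, over the polynomial ring `ℤ[x_{ij}]`. -/
noncomputable def symbolicMatrix : Matrix (Fin n) (Fin n) (MvPolynomial (Fin n × Fin n) ℤ) :=
  Matrix.of fun i j =>
    if i = j then
      if σ.sign (i, true) = -σ.sign (i, false) then MvPolynomial.X (i, i) else 0
    else if i < j then σ.upperEntry i j
    else -σ.upperEntry j i

end SignedRotation

/-- The subsets of `[n]`, as a monoid under union. -/
def UnionMonoid (n : ℕ) : Type := Finset (Fin n)

instance (n : ℕ) : CommMonoid (UnionMonoid n) where
  mul := fun A B : Finset (Fin n) => (A ∪ B : Finset (Fin n))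
  one := (∅ : Finset (Fin n))
  mul_assoc A B C := Finset.union_assoc (α := Fin n) A B C
  mul_comm A B := Finset.union_comm (α := Fin n) A B
  one_mul A := Finset.empty_union (α := Fin n) A
  mul_one A := Finset.union_empty (α := Fin n) A

/-- The ring `ℤ[x_A : A ⊆ [n]]` with `x_A x_B = x_{A ∪ B}` and unit `x_∅`. -/
abbrev SubsetRing (n : ℕ) : Type := MonoidAlgebra ℤ (UnionMonoid n)

namespace SubsetRing

variable {n : ℕ}

/-- The generator `x_A`. -/
noncomputable def x (A : Finset (Fin n)) : SubsetRing n :=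
  MonoidAlgebra.of ℤ (UnionMonoid n) A

/-- `P mod 2`: each integer coefficient is replaced by its remainder `0` or `1` modulo `2`. -/
noncomputable def mod2 (P : SubsetRing n) : SubsetRing n :=
  MonoidAlgebra.ofCoeff (P.coeff.mapRange (fun a : ℤ => a % 2) rfl)

/-- Evaluation at `x_A = 1` for all `A`. -/
noncomputable def evalOne : SubsetRing n →ₐ[ℤ] ℤ :=
  MonoidAlgebra.lift ℤ ℤ (UnionMonoid n) 1

end SubsetRing

/-- The reduction map `f`: the linear map that sends a monomial to `x_A`, where `A` is the union of
the sets `{i, j}` over the indeterminates `x_{ij}` that divide the monomial. -/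
noncomputable def reduction (n : ℕ) : MvPolynomial (Fin n × Fin n) ℤ →ₗ[ℤ] SubsetRing n :=
  (MvPolynomial.basisMonomials (Fin n × Fin n) ℤ).constr ℤ fun m =>
    SubsetRing.x (m.support.biUnion fun p => {p.1, p.2})

/-! Since each `x A` is idempotent, `f` is the ring homomorphism sending `x_{ij}` to `x {i, j}`, so
it commutes with the determinant. In the Leibniz expansion of `det (1 + M)`, choosing the entries of
`M` in exactly the rows of `Y` and those of the identity elsewhere forces the permutation to
preserve `Y`. The coefficient of `x Y` is therefore the principal minor on `Y` of the integer
skew-adjacency matrix (`det_one_add_of_entries`), and only its parity matters.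

The topological core is `isSpanningQuasiTree_iff_det`: in a bouquet, `X` is a spanning quasi-tree
iff that minor is odd. Having one boundary component means that every `ZMod 2`-valued function on
corners that is constant along the boundary of `(V, X)` is constant. Such a function is determined
up to a constant by its jumps `v i` across the line segments. The jumps vanish off `X`, and
agreement across the free sides of the loops in `X` says `(A v) i = 0` for `i ∈ X`
(`add_side_eq_mulVec`). Nonconstant functions thus correspond to nonzero kernel vectors of the
matrix with rows replaced.

Finally, partial duality along `T` translates the spanning quasi-trees by `T`
(`isSpanningQuasiTree_partialDual`). -/

/-! ### The ring of subsets and the reduction map. -/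

namespace SubsetRing

variable {n : ℕ}

theorem x_empty : x (∅ : Finset (Fin n)) = 1 :=
  map_one (MonoidAlgebra.of ℤ (UnionMonoid n))

theorem x_mul_x (A B : Finset (Fin n)) : x A * x B = x (A ∪ B) :=
  (map_mul (MonoidAlgebra.of ℤ (UnionMonoid n)) (show UnionMonoid n from A) B).symm

theorem x_pow (A : Finset (Fin n)) {k : ℕ} (hk : k ≠ 0) : x A ^ k = x A := by
  have h : IsIdempotentElem (x A) := by
    rw [IsIdempotentElem, x_mul_x, Finset.union_self]
  exact h.pow_eq hk

theorem prod_x {ι : Type*} [DecidableEq ι] (s : Finset ι) (g : ι → Finset (Fin n)) :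
    ∏ i ∈ s, x (g i) = x (s.biUnion g) := by
  induction s using Finset.induction_on with
  | empty => simp [x_empty]
  | insert a s ha ih => rw [Finset.prod_insert ha, ih, x_mul_x, Finset.biUnion_insert]

theorem coeff_x (A B : Finset (Fin n)) :
    (x A).coeff (show UnionMonoid n from B) = if A = B then 1 else 0 :=
  Finsupp.single_apply (α := Finset (Fin n))

theorem coeff_sum_zsmul_x (a : Finset (Fin n) → ℤ) (B : Finset (Fin n)) :
    (∑ X, a X • x X).coeff (show UnionMonoid n from B) = a B := by
  rw [MonoidAlgebra.coeff_sum, Finsupp.finsetSum_apply, Finset.sum_eq_single B]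
  · rw [MonoidAlgebra.coeff_smul, Finsupp.smul_apply, coeff_x, if_pos rfl, smul_eq_mul, mul_one]
  · intro b _ hb
    rw [MonoidAlgebra.coeff_smul, Finsupp.smul_apply, coeff_x, if_neg hb, smul_zero]
  · simp

theorem mod2_sum_zsmul_x (a : Finset (Fin n) → ℤ) :
    mod2 (∑ X, a X • x X) = ∑ X, (a X % 2) • x X := by
  apply MonoidAlgebra.coeff_injective
  ext B
  refine Eq.trans ?_ (coeff_sum_zsmul_x (fun X => a X % 2) B).symm
  exact congrArg (· % 2) (coeff_sum_zsmul_x a B)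

theorem evalOne_x (A : Finset (Fin n)) : evalOne (x A) = 1 :=
  MonoidAlgebra.lift_of (1 : UnionMonoid n →* ℤ) (show UnionMonoid n from A)

end SubsetRing

/-- The reduction map is the ring homomorphism that sends `x_{ij}` to `x_A`, `A = {i, j}`. -/
theorem reduction_eq_aeval {n : ℕ} (P : MvPolynomial (Fin n × Fin n) ℤ) :
    reduction n P =
      MvPolynomial.aeval (fun p : Fin n × Fin n => SubsetRing.x {p.1, p.2}) P := by
  suffices h : reduction n = (MvPolynomial.aeval
      (fun p : Fin n × Fin n => SubsetRing.x {p.1, p.2})).toLinearMap from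
    congrArg (fun g => g P) h
  refine (MvPolynomial.basisMonomials (Fin n × Fin n) ℤ).ext fun m => ?_
  rw [reduction, Module.Basis.constr_basis, MvPolynomial.coe_basisMonomials,
    AlgHom.toLinearMap_apply, MvPolynomial.aeval_monomial, map_one, one_mul, Finsupp.prod,
    ← SubsetRing.prod_x]
  refine Finset.prod_congr rfl fun p hp => (SubsetRing.x_pow _ ?_).symm
  exact Finsupp.mem_support_iff.1 hp

/-! ### Expansion of the determinant into principal minors. -/

/-- The identity matrix with the rows in `Y` replaced by those of `a`.  Its determinant is the
principal minor of `a` on `Y`. -/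
def Matrix.replaceRows {ι R : Type*} [DecidableEq ι] [Zero R] [One R] (a : Matrix ι ι R)
    (Y : Finset ι) : Matrix ι ι R :=
  Matrix.of fun i j => if i ∈ Y then a i j else (1 : Matrix ι ι R) i j

/-- If the entries of `M` are integer multiples `a i j` of the generators `x_A`, `A = {i, j}`, then
`det (1 + M)` is the generating function of the principal minors of `a`. -/
theorem det_one_add_of_entries {n : ℕ} (M : Matrix (Fin n) (Fin n) (SubsetRing n))
    (a : Matrix (Fin n) (Fin n) ℤ) (hM : ∀ i j, M i j = a i j • SubsetRing.x {i, j}) :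
    (1 + M).det = ∑ Y, (a.replaceRows Y).det • SubsetRing.x Y := by
  -- `Matrix.det_apply` uses the entries `(π i, i)`; transposing makes the row index the product
  -- variable, to match `replaceRows`.
  rw [← Matrix.det_transpose]
  simp only [← Matrix.det_transpose (a.replaceRows _)]
  simp only [Matrix.det_apply, Matrix.transpose_apply, Finset.sum_smul]
  rw [Finset.sum_comm]
  refine Finset.sum_congr rfl fun π _ => ?_
  simp only [Matrix.add_apply]
  have hexp : ∏ i, ((1 : Matrix (Fin n) (Fin n) (SubsetRing n)) i (π i) + M i (π i)) =
      ∑ Y : Finset (Fin n), (∏ i, a.replaceRows Y i (π i)) • SubsetRing.x Y := by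
    simp only [add_comm ((1 : Matrix (Fin n) (Fin n) (SubsetRing n)) _ _)]
    rw [Finset.prod_add, Finset.powerset_univ]
    refine Finset.sum_congr rfl fun Y _ => ?_
    rw [← Finset.prod_sdiff (Finset.subset_univ Y), mul_comm]
    have h1 : ∏ j ∈ Y, a.replaceRows Y j (π j) = ∏ j ∈ Y, a j (π j) :=
      Finset.prod_congr rfl fun j hj => by simp [Matrix.replaceRows, hj]
    have h2 : ∏ j ∈ Finset.univ \ Y, a.replaceRows Y j (π j) =
        ∏ j ∈ Finset.univ \ Y, (1 : Matrix (Fin n) (Fin n) ℤ) j (π j) :=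
      Finset.prod_congr rfl fun j hj => by
        simp [Matrix.replaceRows, (Finset.mem_sdiff.1 hj).2]
    rw [h1, h2]
    -- If `π` fixes the complement of `Y`, it preserves `Y`, so the sets `{j, π j}` with `j ∈ Y`
    -- have union `Y`. Otherwise an off-diagonal entry of the identity kills both sides.
    by_cases hfix : ∀ j ∉ Y, π j = j
    · have hone : ∀ {R : Type} [CommRing R],
          ∏ j ∈ Finset.univ \ Y, (1 : Matrix (Fin n) (Fin n) R) j (π j) = 1 := by
        intro R _
        refine Finset.prod_eq_one fun j hj => ?_
        rw [hfix j (Finset.mem_sdiff.1 hj).2, Matrix.one_apply_eq]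
      rw [hone, hone, one_mul, one_mul]
      simp only [hM, zsmul_eq_mul, Finset.prod_mul_distrib, Int.cast_prod]
      rw [SubsetRing.prod_x]
      congr 2
      ext k
      simp only [Finset.mem_biUnion, Finset.mem_insert, Finset.mem_singleton]
      constructor
      · rintro ⟨j, hj, rfl | rfl⟩
        · exact hj
        · by_contra hk
          exact hk ((π.injective (hfix _ hk)).symm ▸ hj)
      · exact fun hk => ⟨k, hk, Or.inl rfl⟩
    · push Not at hfix
      obtain ⟨j, hj, hne⟩ := hfix
      have hzero : ∀ {R : Type} [CommRing R],
          ∏ j ∈ Finset.univ \ Y, (1 : Matrix (Fin n) (Fin n) R) j (π j) = 0 := by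
        intro R _
        exact Finset.prod_eq_zero (Finset.mem_sdiff.2 ⟨Finset.mem_univ j, hj⟩)
          (Matrix.one_apply_ne hne.symm)
      rw [hzero, hzero, zero_mul, zero_mul, zero_smul]
  rw [hexp, Finset.smul_sum]
  exact Finset.sum_congr rfl fun Y _ => (smul_assoc _ _ _).symm

/-! ### The skew-adjacency matrix modulo 2. -/

open Classical in
/-- Two pairs of points of a linear order are interlaced exactly if an odd number of the four
comparisons between them hold. -/
theorem interlaced_parity {m : ℕ} {k l p q : Fin m} (hkp : k ≠ p) (hkq : k ≠ q)
    (hlp : l ≠ p) (hlq : l ≠ q) :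
    (if (sbtw k p l ∧ sbtw l q k) ∨ (sbtw k q l ∧ sbtw l p k) then 1 else 0 : ZMod 2) =
      ((if p < k then 1 else 0) + (if q < k then 1 else 0)) +
      ((if p < l then 1 else 0) + (if q < l then 1 else 0)) := by
  have two : (1 + 1 : ZMod 2) = 0 := rfl
  simp only [Fin.sbtw_iff]
  split_ifs <;> first | (simp [two]; done) | (exfalso; omega)

namespace SignedRotation

variable {n : ℕ} (σ : SignedRotation n)

/-- The integer skew-adjacency matrix, obtained by setting all indeterminates to `1`. -/
noncomputable def adjMatrix : Matrix (Fin n) (Fin n) ℤ :=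
  σ.symbolicMatrix.map (MvPolynomial.eval 1)

theorem aeval_upperEntry (i j : Fin n) :
    MvPolynomial.aeval (fun p : Fin n × Fin n => SubsetRing.x {p.1, p.2}) (σ.upperEntry i j) =
      MvPolynomial.eval 1 (σ.upperEntry i j) • SubsetRing.x {i, j} := by
  unfold upperEntry
  split_ifs <;> simp

theorem aeval_symbolicMatrix (i j : Fin n) :
    MvPolynomial.aeval (fun p : Fin n × Fin n => SubsetRing.x {p.1, p.2}) (σ.symbolicMatrix i j) =
      σ.adjMatrix i j • SubsetRing.x {i, j} := by
  simp only [adjMatrix, symbolicMatrix, Matrix.map_apply, Matrix.of_apply]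
  split_ifs with h1 h2 h3
  · subst h1; simp
  · simp
  · exact σ.aeval_upperEntry i j
  · rw [map_neg, map_neg, aeval_upperEntry, neg_smul, Finset.pair_comm]

theorem reduction_det :
    reduction n (1 + σ.symbolicMatrix).det =
      ∑ Y, (σ.adjMatrix.replaceRows Y).det • SubsetRing.x Y := by
  rw [reduction_eq_aeval, AlgHom.map_det, map_add, map_one]
  exact det_one_add_of_entries _ _ σ.aeval_symbolicMatrix

theorem adjMatrix_self (i : Fin n) :
    (σ.adjMatrix i i : ZMod 2) = if σ.sign (i, true) = σ.sign (i, false) then 0 else 1 := by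
  simp only [adjMatrix, symbolicMatrix, Matrix.map_apply, Matrix.of_apply, if_true]
  have h : σ.sign (i, true) = -σ.sign (i, false) ↔ ¬ σ.sign (i, true) = σ.sign (i, false) := by
    rcases Int.units_eq_one_or (σ.sign (i, true)) with h | h <;>
    rcases Int.units_eq_one_or (σ.sign (i, false)) with h' | h' <;> rw [h, h'] <;> decide
  rw [if_congr h rfl rfl]
  split_ifs <;> simp

theorem eval_upperEntry (i j : Fin n) (hij : i ≠ j) :
    ((MvPolynomial.eval 1 (σ.upperEntry i j) : ℤ) : ZMod 2) =
      ((if σ.pos (j, true) < σ.pos (i, true) then 1 else 0) +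
        (if σ.pos (j, false) < σ.pos (i, true) then 1 else 0)) +
      ((if σ.pos (j, true) < σ.pos (i, false) then 1 else 0) +
        (if σ.pos (j, false) < σ.pos (i, false) then 1 else 0)) := by
  rw [← interlaced_parity (by simp [hij]) (by simp [hij]) (by simp [hij]) (by simp [hij])]
  unfold upperEntry CyclicOrder
  have two : (-1 : ZMod 2) = 1 := rfl
  by_cases h1 : sbtw (σ.pos (i, true)) (σ.pos (j, true)) (σ.pos (i, false)) ∧
      sbtw (σ.pos (i, false)) (σ.pos (j, false)) (σ.pos (i, true))
  · rw [if_pos h1, if_pos (Or.inl h1)]; simp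
  · by_cases h2 : sbtw (σ.pos (i, true)) (σ.pos (j, false)) (σ.pos (i, false)) ∧
      sbtw (σ.pos (i, false)) (σ.pos (j, true)) (σ.pos (i, true))
    · rw [if_neg h1, if_pos h2, if_pos (Or.inr h2)]; simp [two]
    · rw [if_neg h1, if_neg h2, if_neg (not_or.2 ⟨h1, h2⟩)]; simp

/-- Modulo 2 the matrix is symmetric, so the comparison count for `i < j` serves both triangles. -/
theorem adjMatrix_of_ne (i j : Fin n) (hij : i ≠ j) :
    (σ.adjMatrix i j : ZMod 2) =
      ((if σ.pos (j, true) < σ.pos (i, true) then 1 else 0) +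
        (if σ.pos (j, false) < σ.pos (i, true) then 1 else 0)) +
      ((if σ.pos (j, true) < σ.pos (i, false) then 1 else 0) +
        (if σ.pos (j, false) < σ.pos (i, false) then 1 else 0)) := by
  simp only [adjMatrix, symbolicMatrix, Matrix.map_apply, Matrix.of_apply, if_neg hij]
  by_cases h : i < j
  · rw [if_pos h, σ.eval_upperEntry i j hij]
  · have flip : ∀ {a b : Fin (2 * n)}, a ≠ b →
        (if a < b then 1 else 0 : ZMod 2) = 1 + if b < a then 1 else 0 := by
      intro a b hab
      rcases lt_or_gt_of_ne hab with h | h <;> simp only [h, h.not_gt, if_true, if_false]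
      · exact (add_zero 1).symm
      · rfl
    rw [if_neg h, map_neg, Int.cast_neg, σ.eval_upperEntry j i hij.symm,
      flip (a := σ.pos (i, true)) (b := σ.pos (j, true)) (by simp [hij]),
      flip (a := σ.pos (i, true)) (b := σ.pos (j, false)) (by simp [hij]),
      flip (a := σ.pos (i, false)) (b := σ.pos (j, true)) (by simp [hij]),
      flip (a := σ.pos (i, false)) (b := σ.pos (j, false)) (by simp [hij])]
    -- Reversing the four comparisons adds `1` four times, which vanishes modulo 2.
    have two : (2 : ZMod 2) = 0 := rfl
    rw [CharTwo.neg_eq]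
    linear_combination 2 * two

end SignedRotation

/-! ### Partial sums along the cyclic sequence. -/

theorem finRotate_mk {m k : ℕ} (h : k + 1 < m) :
    finRotate m ⟨k, Nat.lt_of_succ_lt h⟩ = ⟨k + 1, h⟩ := by
  obtain ⟨m, rfl⟩ : ∃ m', m = m' + 1 := ⟨m - 1, by omega⟩
  exact finRotate_of_lt (by omega)

theorem finRotate_mk_last {m k : ℕ} (h : k + 1 = m) :
    finRotate m ⟨k, by omega⟩ = ⟨0, by omega⟩ := by
  subst h
  exact finRotate_last'

namespace SignedRotation

variable {n : ℕ} (σ : SignedRotation n) (v : Fin n → ZMod 2)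

/-- The sum of the values of `v` on the labels at the positions before `k`. -/
def partialSum (k : ℕ) : ZMod 2 :=
  ∑ p : Fin n × Bool, if (σ.pos p : ℕ) < k then v p.1 else 0

theorem partialSum_zero : σ.partialSum v 0 = 0 := by simp [partialSum]

theorem partialSum_succ (k : Fin (2 * n)) :
    σ.partialSum v (k + 1) = σ.partialSum v k + v (σ.pos.symm k).1 := by
  have h : v (σ.pos.symm k).1 = ∑ p : Fin n × Bool, if p = σ.pos.symm k then v p.1 else 0 := by
    simp
  rw [h, partialSum, partialSum, ← Finset.sum_add_distrib]
  refine Finset.sum_congr rfl fun p _ => ?_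
  simp only [Equiv.eq_symm_apply, Fin.ext_iff]
  split_ifs <;> first | omega | simp

theorem partialSum_eq_sum (k : ℕ) :
    σ.partialSum v k = ∑ j, ((if (σ.pos (j, true) : ℕ) < k then 1 else 0) +
      (if (σ.pos (j, false) : ℕ) < k then 1 else 0)) * v j := by
  rw [partialSum, Fintype.sum_prod_type]
  refine Finset.sum_congr rfl fun j _ => ?_
  rw [Fintype.sum_bool, add_mul, ite_mul, ite_mul, one_mul, zero_mul]

/-- Every label occurs twice, so a full turn contributes nothing; this lets the partial sums close
up around the vertex. -/
theorem partialSum_two_mul : σ.partialSum v (2 * n) = 0 := by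
  rw [partialSum_eq_sum]
  refine Finset.sum_eq_zero fun j _ => ?_
  rw [if_pos (Fin.is_lt _), if_pos (Fin.is_lt _), CharTwo.add_self_eq_zero, zero_mul]

/-- Between the two occurrences of `i` one crosses `i` once, and an odd number of occurrences of
another label exactly if it is interlaced with `i`. -/
theorem partialSum_add_partialSum (i : Fin n) :
    σ.partialSum v (σ.pos (i, true)) + σ.partialSum v (σ.pos (i, false)) =
      ∑ j, (σ.adjMatrix i j : ZMod 2) * v j +
        if σ.sign (i, true) = σ.sign (i, false) then v i else 0 := by
  have hi : (if σ.sign (i, true) = σ.sign (i, false) then v i else 0) =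
      ∑ j, if j = i then (if σ.sign (i, true) = σ.sign (i, false) then v j else 0) else 0 := by
    simp
  rw [hi, partialSum_eq_sum, partialSum_eq_sum, ← Finset.sum_add_distrib,
    ← Finset.sum_add_distrib]
  refine Finset.sum_congr rfl fun j _ => ?_
  rw [← add_mul]
  by_cases hj : j = i
  · subst hj
    have hne : (σ.pos (j, true) : ℕ) ≠ σ.pos (j, false) := by
      rw [Ne, ← Fin.ext_iff]; simp
    -- On the diagonal exactly one occurrence of `i` precedes the other, giving `v i`: this is the
    -- diagonal term if the signs differ and the correction term if they agree.
    rw [adjMatrix_self, if_pos rfl, if_neg (lt_irrefl _), if_neg (lt_irrefl _)]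
    rcases lt_or_gt_of_ne hne with h | h <;> rw [if_pos h, if_neg h.not_gt] <;>
      split_ifs <;> ring
  · rw [if_neg hj, add_zero, σ.adjMatrix_of_ne i j (Ne.symm hj)]
    rfl

end SignedRotation

/-! ### Corners of a bouquet read off from the rotation. -/

namespace RibbonGraph

variable {n : ℕ} {B : RibbonGraph (Fin n)} {σ : SignedRotation n} {c : Fin (2 * n) → B.Corner}

/-- A free side of the loop `i` leads from one of its half-edges to the other. -/
theorem side_corner (hinj : ∀ k l, c l = c k ∨ c l = B.seg (c k) → k = l)
    (hlab : ∀ k, B.edge (c k) = (σ.pos.symm k).1) (i : Fin n) :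
    B.side (c (σ.pos (i, true))) = c (σ.pos (i, false)) ∨
      B.side (c (σ.pos (i, true))) = B.seg (c (σ.pos (i, false))) := by
  have hne : σ.pos (i, true) ≠ σ.pos (i, false) := by simp
  have he : B.edge (c (σ.pos (i, true))) = B.edge (c (σ.pos (i, false))) := by
    rw [hlab, hlab]; simp
  rcases (B.edge_eq_iff _ _).1 he with h | h | h | h
  · exact absurd (hinj _ _ (Or.inl h)) hne
  · exact absurd (hinj _ _ (Or.inr h)) hne
  · exact Or.inl h.symm
  · exact Or.inr (by rw [h, B.seg_seg])

/-- The two occurrences of a loop have distinct line segments, whose ends account for all four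
corners of its rectangle. -/
theorem exists_corner (hinj : ∀ k l, c l = c k ∨ c l = B.seg (c k) → k = l)
    (hlab : ∀ k, B.edge (c k) = (σ.pos.symm k).1) (x : B.Corner) :
    ∃ k, x = c k ∨ x = B.seg (c k) := by
  have he : B.edge (c (σ.pos (B.edge x, true))) = B.edge x := by rw [hlab]; simp
  rcases (B.edge_eq_iff _ _).1 he with h | h | h | h
  · exact ⟨_, Or.inl h⟩
  · exact ⟨_, Or.inr h⟩
  · refine ⟨σ.pos (B.edge x, false), ?_⟩
    rcases side_corner hinj hlab (B.edge x) with h' | h'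
    · exact Or.inl (h.trans h')
    · exact Or.inr (h.trans h')
  · refine ⟨σ.pos (B.edge x, false), ?_⟩
    rcases side_corner hinj hlab (B.edge x) with h' | h'
    · exact Or.inr (h.trans (congrArg B.seg h'))
    · exact Or.inl (h.trans ((congrArg B.seg h').trans (B.seg_seg _)))

/-- The corners are the ends of the half-edges met around the vertex. -/
noncomputable def cornerEquiv (hinj : ∀ k l, c l = c k ∨ c l = B.seg (c k) → k = l)
    (hlab : ∀ k, B.edge (c k) = (σ.pos.symm k).1) : Fin (2 * n) × Bool ≃ B.Corner :=
  Equiv.ofBijective (fun p => if p.2 then B.seg (c p.1) else c p.1) <| by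
    constructor
    · rintro ⟨k, b⟩ ⟨l, b'⟩ h
      cases b <;> cases b' <;> simp only [if_true, Bool.false_eq_true, if_false] at h
      · rw [hinj _ _ (Or.inl h)]
      · have := hinj _ _ (Or.inr h)
        subst this
        exact absurd h.symm (B.seg_ne _)
      · have := hinj _ _ (Or.inr h.symm)
        subst this
        exact absurd h (B.seg_ne _)
      · have h' := congrArg B.seg h
        rw [B.seg_seg, B.seg_seg] at h'
        rw [hinj _ _ (Or.inl h')]
    · intro x
      obtain ⟨k, h | h⟩ := exists_corner hinj hlab x
      · exact ⟨(k, false), h.symm⟩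
      · exact ⟨(k, true), h.symm⟩

/-- A function on the corners may be prescribed at both ends of each half-edge. -/
theorem exists_function_of_corners (hinj : ∀ k l, c l = c k ∨ c l = B.seg (c k) → k = l)
    (hlab : ∀ k, B.edge (c k) = (σ.pos.symm k).1) {α : Type*} (f g : Fin (2 * n) → α) :
    ∃ h : B.Corner → α, (∀ k, h (c k) = f k) ∧ ∀ k, h (B.seg (c k)) = g k := by
  refine ⟨fun x => (fun p : Fin (2 * n) × Bool => if p.2 then g p.1 else f p.1)
    ((cornerEquiv hinj hlab).symm x), fun k => ?_, fun k => ?_⟩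
  · have : c k = cornerEquiv hinj hlab (k, false) := rfl
    simp only [this, Equiv.symm_apply_apply]
    rfl
  · have : B.seg (c k) = cornerEquiv hinj hlab (k, true) := rfl
    simp only [this, Equiv.symm_apply_apply]
    rfl

/-- A symmetric relation holds along all arcs if it holds along those met when going once around
the vertex. -/
theorem forall_arc_of_corners (hrot : ∀ k, c (finRotate (2 * n) k) = B.arc (B.seg (c k)))
    (hinj : ∀ k l, c l = c k ∨ c l = B.seg (c k) → k = l)
    (hlab : ∀ k, B.edge (c k) = (σ.pos.symm k).1) {r : B.Corner → B.Corner → Prop}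
    (hr : ∀ x y, r x y → r y x) (h : ∀ k, r (B.seg (c k)) (c (finRotate (2 * n) k)))
    (x : B.Corner) : r x (B.arc x) := by
  obtain ⟨k, rfl | rfl⟩ := exists_corner hinj hlab x
  · obtain ⟨l, rfl⟩ := (finRotate (2 * n)).surjective k
    have := hr _ _ (h l)
    rwa [hrot l, B.arc_arc, ← hrot l]
  · rw [← hrot]
    exact h k

theorem eq_of_finRotate {α : Type*} {m : ℕ} (f : Fin m → α)
    (h : ∀ k, f (finRotate m k) = f k) (k l : Fin m) : f k = f l := by
  have h0 : ∀ (k : ℕ) (hk : k < m), f ⟨k, hk⟩ = f ⟨0, by omega⟩ := by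
    intro k
    induction k with
    | zero => exact fun _ => rfl
    | succ k ih =>
      intro hk
      rw [← finRotate_mk hk, h, ih]
  exact (h0 k k.2).trans (h0 l l.2).symm

/-- An orientation is constant on the entry corners `c k`, since passing a segment and then an arc
flips it twice. So the loop is orientable exactly when a free side joins an entry corner to an exit
corner. -/
theorem isOrientable_singleton_iff
    (hrot : ∀ k, c (finRotate (2 * n) k) = B.arc (B.seg (c k)))
    (hinj : ∀ k l, c l = c k ∨ c l = B.seg (c k) → k = l)
    (hlab : ∀ k, B.edge (c k) = (σ.pos.symm k).1) (i : Fin n) :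
    B.IsOrientable {i} ↔ B.side (c (σ.pos (i, true))) = B.seg (c (σ.pos (i, false))) := by
  constructor
  · rintro ⟨o, hseg, harc, hside⟩
    have hc : ∀ k l, o (c k) = o (c l) := eq_of_finRotate (fun k => o (c k)) fun k => by
      simp only [hrot, harc, hseg, Bool.not_not]
    refine (side_corner hinj hlab i).resolve_left fun h => ?_
    have := hside (c (σ.pos (i, true))) (by rw [hlab]; simp)
    rw [h, hc _ (σ.pos (i, true))] at this
    simp at this
  · intro h
    obtain ⟨o, ho, ho'⟩ := exists_function_of_corners hinj hlab (fun _ => true) (fun _ => false)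
    have hseg : ∀ x, o (B.seg x) = !o x := by
      intro x
      obtain ⟨k, rfl | rfl⟩ := exists_corner hinj hlab x
      · rw [ho, ho']; rfl
      · rw [B.seg_seg, ho, ho']; rfl
    refine ⟨o, hseg, ?_, ?_⟩
    · refine forall_arc_of_corners hrot hinj hlab (r := fun x y => o y = !o x) ?_ ?_
      · intro x y hxy
        rw [hxy, Bool.not_not]
      · intro k
        rw [ho, ho']; rfl
    · intro x hx
      have h0 : o (B.side (c (σ.pos (i, true)))) = !o (c (σ.pos (i, true))) := by
        rw [h, ho, ho']; rfl
      have he : B.edge (c (σ.pos (i, true))) = B.edge x := by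
        rw [hlab, Finset.mem_singleton.1 hx]; simp
      rcases (B.edge_eq_iff _ _).1 he with rfl | rfl | rfl | rfl
      · exact h0
      · rw [← B.seg_side, hseg, hseg, h0]
      · rw [B.side_side, h0, Bool.not_not]
      · rw [← B.seg_side, B.side_side, hseg, hseg, h0, Bool.not_not]

/-- A function on the corners that is constant along arcs and jumps by `v i` across both line
segments of the loop `i` changes along a free side of `i` by the `i`-th entry of `A v`. -/
theorem add_side_eq_mulVec (hσ : B.IsSignedRotation σ)
    (hrot : ∀ k, c (finRotate (2 * n) k) = B.arc (B.seg (c k)))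
    (hinj : ∀ k l, c l = c k ∨ c l = B.seg (c k) → k = l)
    (hlab : ∀ k, B.edge (c k) = (σ.pos.symm k).1)
    (h : B.Corner → ZMod 2) (v : Fin n → ZMod 2) (harc : ∀ x, h (B.arc x) = h x)
    (hseg : ∀ x, h (B.seg x) = h x + v (B.edge x)) (i : Fin n) :
    h (c (σ.pos (i, true))) + h (B.side (c (σ.pos (i, true)))) =
      ∑ j, (σ.adjMatrix i j : ZMod 2) * v j := by
  -- Going around the vertex, `h` accumulates the jumps of the segments already crossed.
  have hpos : ∀ (k : ℕ) (hk : k < 2 * n), h (c ⟨k, hk⟩) =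
      h (c ⟨0, by omega⟩) + σ.partialSum v k := by
    intro k
    induction k with
    | zero => intro _; rw [σ.partialSum_zero, add_zero]
    | succ k ih =>
      intro hk
      rw [← finRotate_mk hk, hrot, harc, hseg, ih, hlab, add_assoc,
        ← σ.partialSum_succ v ⟨k, Nat.lt_of_succ_lt hk⟩]
  have hsum := σ.partialSum_add_partialSum v i
  have hcc : h (c (σ.pos (i, true))) + h (c (σ.pos (i, false))) =
      σ.partialSum v (σ.pos (i, true)) + σ.partialSum v (σ.pos (i, false)) := by
    rw [hpos _ (σ.pos (i, true)).2, hpos _ (σ.pos (i, false)).2, add_add_add_comm,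
      CharTwo.add_self_eq_zero, zero_add]
  -- For an orientable loop the side ends at the exit corner; the extra jump `v i` cancels the
  -- correction term of `partialSum_add_partialSum`.
  by_cases ho : B.side (c (σ.pos (i, true))) = B.seg (c (σ.pos (i, false)))
  · rw [if_pos ((hσ.2 i).2 ((isOrientable_singleton_iff hrot hinj hlab i).2 ho))] at hsum
    rw [ho, hseg, ← add_assoc, hcc, hsum, hlab, Equiv.symm_apply_apply, add_assoc,
      CharTwo.add_self_eq_zero, add_zero]
  · rw [if_neg (fun hs => ho ((isOrientable_singleton_iff hrot hinj hlab i).1 ((hσ.2 i).1 hs))),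
      add_zero] at hsum
    rw [(side_corner hinj hlab i).resolve_right ho, hcc, hsum]

/-! ### Spanning quasi-trees of a bouquet and kernels modulo 2. -/

/-- In a bouquet, `X` is a spanning quasi-tree exactly if the functions that are constant along
the boundary of `(V, X)` are the constant ones. -/
theorem isSpanningQuasiTree_iff_forall_eq {E : Type} [DecidableEq E] {B : RibbonGraph E}
    (hB : B.IsBouquet) (X : Finset E) :
    B.IsSpanningQuasiTree X ↔ ∀ h : B.Corner → ZMod 2, (∀ x, h (B.arc x) = h x) →
      (∀ x, h (B.turn X x) = h x) → ∀ x y, h x = h y := by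
  obtain ⟨_, ⟨w⟩⟩ := Nat.card_eq_one_iff_unique.1 hB
  rw [IsSpanningQuasiTree, Nat.card_eq_one_iff_unique]
  constructor
  · rintro ⟨hsub, -⟩ h harc hturn x y
    have hq : (Quot.mk (fun a b : B.Corner => b = B.turn X a ∨ b = B.arc a) x) = Quot.mk _ y :=
      Sum.inl_injective (hsub.elim (Sum.inl (Quot.mk _ x)) (Sum.inl (Quot.mk _ y)))
    refine congrArg (Quot.lift h ?_) hq
    rintro a b (rfl | rfl)
    · exact (hturn a).symm
    · exact (harc a).symm
  · intro H
    constructor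
    · constructor
      rintro (a | ⟨u, hu⟩) (b | ⟨u', hu'⟩)
      · congr 1
        induction a using Quot.ind with | _ x
        induction b using Quot.ind with | _ y
        classical
        -- The indicator of the boundary component of `y` is constant along the boundary, so it is
        -- constant.
        have := H (fun z => if Quot.mk (fun a b : B.Corner => b = B.turn X a ∨ b = B.arc a) z =
          Quot.mk _ y then 1 else 0) ?_ ?_ x y
        · by_contra hne
          rw [if_neg hne, if_pos rfl] at this
          exact zero_ne_one this
        · intro z
          rw [Quot.sound (r := fun a b : B.Corner => b = B.turn X a ∨ b = B.arc a)
            (Or.inr rfl : B.arc z = B.turn X z ∨ B.arc z = B.arc z)]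
        · intro z
          rw [Quot.sound (r := fun a b : B.Corner => b = B.turn X a ∨ b = B.arc a)
            (Or.inl rfl : B.turn X z = B.turn X z ∨ B.turn X z = B.arc z)]
      · induction a using Quot.ind with | _ x
        exact absurd ⟨x, Subsingleton.elim _ _⟩ hu'
      · induction b using Quot.ind with | _ x
        exact absurd ⟨x, Subsingleton.elim _ _⟩ hu
      · congr 2
        exact Subsingleton.elim _ _
    -- If the only vertex carries no corner, its own boundary circle is the required component.
    · by_cases hw : w ∈ Set.range B.vert
      · obtain ⟨x, -⟩ := hw
        exact ⟨Sum.inl (Quot.mk _ x)⟩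
      · exact ⟨Sum.inr ⟨w, hw⟩⟩

/-- The spanning quasi-trees of a bouquet are the non-singular principal minors modulo `2` of its
skew-adjacency matrix. -/
theorem isSpanningQuasiTree_iff_det (hB : B.IsBouquet) (hσ : B.IsSignedRotation σ)
    (X : Finset (Fin n)) :
    B.IsSpanningQuasiTree X ↔ (((σ.adjMatrix.replaceRows X).det : ℤ) : ZMod 2) ≠ 0 := by
  obtain ⟨c, hrot, hinj, hlab⟩ := hσ.1
  have hdet : (((σ.adjMatrix.replaceRows X).det : ℤ) : ZMod 2) =
      ((σ.adjMatrix.replaceRows X).map (Int.cast : ℤ → ZMod 2)).det :=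
    (Int.castRingHom (ZMod 2)).map_det _
  have hmul : ∀ (v : Fin n → ZMod 2) (i : Fin n),
      ((σ.adjMatrix.replaceRows X).map (Int.cast : ℤ → ZMod 2)).mulVec v i =
        if i ∈ X then ∑ j, (σ.adjMatrix i j : ZMod 2) * v j else v i := by
    intro v i
    rw [Matrix.mulVec, dotProduct]
    split_ifs with hi
    · simp [Matrix.replaceRows, hi]
    · simp [Matrix.replaceRows, hi, Matrix.one_apply]
  have hcorner : ∀ x, ∃ i, B.edge x = i ∧ B.edge (c (σ.pos (i, true))) = B.edge x := by
    intro x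
    exact ⟨_, rfl, by rw [hlab]; simp⟩
  rw [isSpanningQuasiTree_iff_forall_eq hB, hdet, ← not_iff_not, not_not,
    ← Matrix.exists_mulVec_eq_zero_iff]
  constructor
  · intro H
    push Not at H
    obtain ⟨h, harc, hturn, x, y, hxy⟩ := H
    -- The jump is defined at one segment of each loop; `hseg` shows that the other segment has the
    -- same jump, because `h` agrees across the free sides of loops in `X`, while loops outside `X`
    -- have jump zero.
    set v : Fin n → ZMod 2 := fun i =>
      h (c (σ.pos (i, true))) + h (B.seg (c (σ.pos (i, true)))) with hv
    have hside : ∀ x, B.edge x ∈ X → h (B.side x) = h x := fun x hx => by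
      have := hturn x
      rwa [turn, if_pos hx] at this
    have hv0 : ∀ i ∉ X, v i = 0 := fun i hi => by
      have := hturn (c (σ.pos (i, true)))
      rw [turn, if_neg (by rw [hlab]; simpa using hi)] at this
      rw [hv]
      simp only [this, CharTwo.add_self_eq_zero]
    have hseg : ∀ x, h (B.seg x) = h x + v (B.edge x) := by
      intro x
      by_cases hx : B.edge x ∈ X
      · obtain ⟨i, hi, he⟩ := hcorner x
        rw [hi]
        have hc : B.edge (c (σ.pos (i, true))) ∈ X := he ▸ hx
        simp only [hv]
        rcases (B.edge_eq_iff _ _).1 he with h' | h' | h' | h' <;> rw [h']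
        · rw [← add_assoc, CharTwo.add_self_eq_zero, zero_add]
        · rw [B.seg_seg, add_comm, add_assoc, CharTwo.add_self_eq_zero, add_zero]
        · rw [B.seg_side, hside _ ((B.edge_seg _).symm ▸ hc), hside _ hc, ← add_assoc,
            CharTwo.add_self_eq_zero, zero_add]
        · rw [B.seg_seg, B.seg_side, hside _ hc, hside _ ((B.edge_seg _).symm ▸ hc), add_comm,
            add_assoc, CharTwo.add_self_eq_zero, add_zero]
      · have := hturn x
        rw [turn, if_neg hx] at this
        rw [this, hv0 _ hx, add_zero]
    refine ⟨v, fun h0 => hxy ?_, funext fun i => ?_⟩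
    · have hs : ∀ x, h (B.seg x) = h x := fun x => by rw [hseg, h0, Pi.zero_apply, add_zero]
      have hc : ∀ k l, h (c k) = h (c l) := eq_of_finRotate (fun k => h (c k)) fun k => by
        simp only [hrot, harc, hs]
      obtain ⟨k, rfl | rfl⟩ := exists_corner hinj hlab x <;>
      obtain ⟨l, rfl | rfl⟩ := exists_corner hinj hlab y <;> (try simp only [hs]) <;> exact hc _ _
    · rw [hmul]
      split_ifs with hi
      · rw [← add_side_eq_mulVec hσ hrot hinj hlab h v harc hseg,
          hside _ (by rw [hlab]; simpa using hi), CharTwo.add_self_eq_zero]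
        rfl
      · exact hv0 i hi
  · rintro ⟨v, hv, hker⟩ H
    have hker' : ∀ i, (if i ∈ X then ∑ j, (σ.adjMatrix i j : ZMod 2) * v j else v i) = 0 :=
      fun i => by rw [← hmul, hker]; rfl
    -- Conversely, a kernel vector is integrated around the vertex: the partial sums before and
    -- after position `k` are the values at its entry and exit corners.
    obtain ⟨h, hh, hh'⟩ := exists_function_of_corners hinj hlab
      (fun k => σ.partialSum v k) (fun k => σ.partialSum v (k + 1))
    have hseg : ∀ x, h (B.seg x) = h x + v (B.edge x) := by
      intro x
      obtain ⟨k, rfl | rfl⟩ := exists_corner hinj hlab x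
      · rw [hh, hh', σ.partialSum_succ, hlab]
      · rw [B.seg_seg, hh, hh', σ.partialSum_succ, B.edge_seg, hlab, add_assoc,
          CharTwo.add_self_eq_zero, add_zero]
    have harc : ∀ x, h (B.arc x) = h x := by
      refine forall_arc_of_corners hrot hinj hlab (r := fun x y => h y = h x)
        (fun x y => Eq.symm) fun ⟨k, hk⟩ => ?_
      rw [hh, hh']
      by_cases hk' : k + 1 < 2 * n
      · rw [finRotate_mk hk']
      · have hk'' : k + 1 = 2 * n := by omega
        rw [finRotate_mk_last hk'']
        simp only [hk'', σ.partialSum_zero, σ.partialSum_two_mul]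
    have hturn : ∀ x, h (B.turn X x) = h x := by
      intro x
      rw [turn]
      obtain ⟨i, hi, he⟩ := hcorner x
      have hk := hker' i
      rw [hi]
      split_ifs with hx
      · rw [if_pos hx, ← add_side_eq_mulVec hσ hrot hinj hlab h v harc hseg,
          CharTwo.add_eq_zero] at hk
        -- Agreement along one free side gives it along the other, as both segments have the same
        -- jump.
        rcases (B.edge_eq_iff _ _).1 he with h' | h' | h' | h' <;> rw [h']
        · exact hk.symm
        · rw [← B.seg_side, hseg, hseg, B.edge_side, hk]
        · rw [B.side_side, hk]
        · rw [← B.seg_side, B.side_side, hseg, hseg, B.edge_side, hk]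
      · rw [if_neg hx] at hk
        rw [hseg, hi, hk, add_zero]
    refine hv (funext fun i => ?_)
    have := hseg (c (σ.pos (i, true)))
    rw [H h harc hturn _ (c (σ.pos (i, true))), hlab, Equiv.symm_apply_apply] at this
    exact left_eq_add.1 this

end RibbonGraph

/-! ### Spanning quasi-trees under partial duality. -/

namespace RibbonGraph

variable {E : Type} [DecidableEq E] (G : RibbonGraph E)

/-- Dualising swaps segments with free sides on the edges of `T`, so the choice made by `turn` is
reversed exactly there. -/
theorem turn_partialDual (T X : Finset E) (x : G.Corner) :
    (G.partialDual T).turn X x = G.turn (symmDiff X T) x := by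
  change (if G.edge x ∈ X then (if G.edge x ∈ T then G.seg x else G.side x) else G.turn T x) = _
  by_cases hX : G.edge x ∈ X <;> by_cases hT : G.edge x ∈ T <;>
    simp [turn, Finset.mem_symmDiff, hX, hT]

theorem inl_mem_range_vert_partialDual (T : Finset E)
    (q : Quot (fun a b : G.Corner => b = G.turn T a ∨ b = G.arc a)) :
    (Sum.inl q : G.BoundaryComponent T) ∈ Set.range (G.partialDual T).vert := by
  obtain ⟨x, rfl⟩ := Quot.exists_rep q
  exact ⟨x, rfl⟩

/-- The isolated vertices of a partial dual are those of the ribbon graph. -/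
def isolatedPartialDualEquiv (T : Finset E) :
    {v : (G.partialDual T).Vertex // v ∉ Set.range (G.partialDual T).vert} ≃
      {v : G.Vertex // v ∉ Set.range G.vert} where
  toFun
    | ⟨Sum.inl q, h⟩ => (h (G.inl_mem_range_vert_partialDual T q)).elim
    | ⟨Sum.inr v, _⟩ => v
  invFun v := ⟨Sum.inr v, by rintro ⟨x, hx⟩; exact Sum.inl_ne_inr hx⟩
  left_inv
    | ⟨Sum.inl q, h⟩ => (h (G.inl_mem_range_vert_partialDual T q)).elim
    | ⟨Sum.inr _, _⟩ => rfl
  right_inv _ := rfl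

/-- The arcs are unchanged and the turns agree, so the boundary curves coincide; isolated vertices
also correspond. -/
theorem isSpanningQuasiTree_partialDual (T X : Finset E) :
    (G.partialDual T).IsSpanningQuasiTree X ↔ G.IsSpanningQuasiTree (symmDiff X T) := by
  have hturn : (G.partialDual T).turn X = G.turn (symmDiff X T) :=
    funext (G.turn_partialDual T X)
  have e : (G.partialDual T).BoundaryComponent X ≃ G.BoundaryComponent (symmDiff X T) :=
    Equiv.sumCongr (Quot.congr (Equiv.refl G.Corner) fun a b => by rw [hturn]; rfl)
      (G.isolatedPartialDualEquiv T)
  rw [IsSpanningQuasiTree, IsSpanningQuasiTree, Nat.card_congr e]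

end RibbonGraph

/-! ### The generating function and the count. -/

theorem corollary4p5 {n : ℕ} (G : RibbonGraph (Fin n)) (hG : G.Connected)
    (T : Finset (Fin n)) (hT : G.IsSpanningQuasiTree T) :
    (G.partialDual T).IsBouquet ∧
    ∀ σ : SignedRotation n, (G.partialDual T).IsSignedRotation σ →
      SubsetRing.mod2 (reduction n (1 + σ.symbolicMatrix).det) =
          (∑ X : Finset (Fin n) with G.IsSpanningQuasiTree (symmDiff X T), SubsetRing.x X) ∧
      (G.numSpanningQuasiTrees : ℤ) =
          SubsetRing.evalOne (SubsetRing.mod2 (reduction n (1 + σ.symbolicMatrix).det)) := by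
  -- The vertices of the partial dual are by definition the boundary components of `(V(G), T)`.
  have hB : (G.partialDual T).IsBouquet := hT
  refine ⟨hB, fun σ hσ => ?_⟩
  have hmod : SubsetRing.mod2 (reduction n (1 + σ.symbolicMatrix).det) =
      ∑ X : Finset (Fin n) with G.IsSpanningQuasiTree (symmDiff X T), SubsetRing.x X := by
    rw [σ.reduction_det, SubsetRing.mod2_sum_zsmul_x, Finset.sum_filter]
    refine Finset.sum_congr rfl fun X _ => ?_
    have hX : G.IsSpanningQuasiTree (symmDiff X T) ↔
        ¬ (2 : ℤ) ∣ (σ.adjMatrix.replaceRows X).det := by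
      rw [← G.isSpanningQuasiTree_partialDual, RibbonGraph.isSpanningQuasiTree_iff_det hB hσ, Ne,
        ZMod.intCast_zmod_eq_zero_iff_dvd]
      rfl
    split_ifs with h
    · rw [Int.emod_two_ne_zero.1 fun h0 => hX.1 h (Int.dvd_of_emod_eq_zero h0), one_smul]
    · rw [Int.emod_eq_zero_of_dvd (not_not.1 fun h0 => h (hX.2 h0)), zero_smul]
  refine ⟨hmod, ?_⟩
  rw [hmod, map_sum]
  simp only [SubsetRing.evalOne_x, Finset.sum_const, nsmul_eq_mul, mul_one]
  rw [RibbonGraph.numSpanningQuasiTrees, ← Fintype.card_subtype, ← Nat.card_eq_fintype_card]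
  congr 1
  -- The involution `X ↦ symmDiff X T` matches the summation index with the spanning quasi-trees
  -- themselves.
  refine Nat.card_congr (Equiv.subtypeEquiv (symmDiff_left_involutive T).toPerm fun A => ?_)
  change _ ↔ G.IsSpanningQuasiTree (symmDiff (symmDiff A T) T)
  rw [symmDiff_symmDiff_cancel_right]
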